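/- Let $\varphi$ be the Laplace transform of a probability law $\mu$ on $[0,\infty)$, i.e. $\varphi(z)=\int e^{-zx}\,\mu(dx)$ for $\operatorname{Re} z\ge 0$. A probability law $\nu$ on $\mathbb{R}$ with characteristic function $f$ is called $\varphi$-infinitely divisible ($\varphi$-ID) if there are constants $a_n>0$ and characteristic functions $f_n$ of probability laws on $\mathbb{R}$ such that $f(t)=\lim_{n\to\infty}\varphi\{a_n(1-f_n(t))\}$ for every $t\in\mathbb{R}$. Theorem. A probability law $\nu$ on $\mathbb{R}$ is $\varphi$-ID if and only if it is the limit law, as $\theta\downarrow 0$, of $N_\theta$-sums of i.i.d. random variables whose classical sums have a limit law, where $N_\theta$ has probability generating function $\varphi\{(1-s)/\theta\}$. The latter condition means: for every $\theta>0$ there are, on some probability space, i.i.d. real random variables $X_{\theta,1},X_{\theta,2},\dots$ and a random variable $N_\theta$ with values in $\{0,1,2,\dots\}$, independent of the sequence $(X_{\theta,j})_{j\ge1}$, with $E\,s^{N_\theta}=\varphi\{(1-s)/\theta\}$ for $0<s<1$, such that, as $\theta\downarrow0$, the sums $\sum_{j=1}^{\lfloor 1/\theta\rfloor}X_{\theta,j}$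 converge in law to some probability law on $\mathbb{R}$, and the sums $\sum_{j=1}^{N_\theta}X_{\theta,j}$ converge in law to $\nu$. -/

import Mathlib

open MeasureTheory ProbabilityTheory Filter Topology

universe u

/-- `φ` is the Laplace transform of a probability law `μ` on `[0, ∞)`, regarded as a function on
the closed right half plane. -/
def IsLaplaceTransform (φ : ℂ → ℂ) : Prop :=
  ∃ μ : Measure ℝ, IsProbabilityMeasure μ ∧ (∀ᵐ x ∂μ, 0 ≤ x) ∧
    ∀ z : ℂ, 0 ≤ z.re → φ z = ∫ x : ℝ, Complex.exp (-(z * x)) ∂μ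

/-- The probability law `ν` on `ℝ` is `φ`-infinitely divisible: its characteristic function is the
pointwise limit of `φ (aₙ (1 - fₙ(t)))` with `aₙ > 0` and `fₙ` characteristic functions. -/
def IsPhiID (φ : ℂ → ℂ) (ν : Measure ℝ) : Prop :=
  ∃ (a : ℕ → ℝ) (κ : ℕ → Measure ℝ), (∀ n, 0 < a n) ∧ (∀ n, IsProbabilityMeasure (κ n)) ∧
    ∀ t : ℝ, Tendsto (fun n => φ (a n * (1 - charFun (κ n) t))) atTop (𝓝 (charFun ν t))

/-- `Q` gives the values on `(0, 1)` of the probability generating function of `N`. -/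
def HasPGF {Ω : Type u} [MeasurableSpace Ω] (P : Measure Ω) (N : Ω → ℕ) (Q : ℝ → ℂ) : Prop :=
  ∀ s : ℝ, 0 < s → s < 1 → ((∫ ω, s ^ N ω ∂P : ℝ) : ℂ) = Q s

/-- The random variables `X 0, X 1, …` are i.i.d., and the sequence they form is independent of the
`ℕ`-valued random variable `N`. -/
structure IsRandomSumModel {Ω : Type u} [MeasurableSpace Ω] (P : Measure Ω) (N : Ω → ℕ)
    (X : ℕ → Ω → ℝ) : Prop where
  measurable_N : Measurable N
  measurable_X : ∀ j, Measurable (X j)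
  indep_X : iIndepFun X P
  identDistrib_X : ∀ j, IdentDistrib (X j) (X 0) P P
  indep_N_X : IndepFun N (fun ω j => X j ω) P

/-- The filter `θ → 0` on the parameter space `(0, ∞)`. -/
def thetaToZero : Filter (Set.Ioi (0 : ℝ)) :=
  comap (fun θ : Set.Ioi (0 : ℝ) => (θ : ℝ)) (𝓝 0)

/-- The laws of the random variables `S θ` (each on its own probability space) converge weakly to
the probability law `ν` as `θ → 0`. -/
def HasLimitLaw {Ω : Set.Ioi (0 : ℝ) → Type u} [∀ θ, MeasurableSpace (Ω θ)]
    (P : ∀ θ, Measure (Ω θ)) [∀ θ, IsProbabilityMeasure (P θ)] (S : ∀ θ, Ω θ → ℝ)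
    (ν : Measure ℝ) [IsProbabilityMeasure ν] : Prop :=
  TendstoInDistribution S thetaToZero (id : ℝ → ℝ) P ν

/-- `ν` is the limit law, as `θ → 0`, of the sums `X θ 0 + ⋯ + X θ (N θ - 1)`. For each `θ > 0` the
summands `X θ j`, `j = 0, 1, …`, are i.i.d. and independent of `N θ`, which has generating function
`s ↦ φ ((1 - s) / θ)`; the classical sums of the first `⌊1/θ⌋` summands have a limit law too. -/
def IsLimitOfRandomSums (φ : ℂ → ℂ) (ν : Measure ℝ) [IsProbabilityMeasure ν] : Prop :=
  ∃ (Ω : Set.Ioi (0 : ℝ) → Type u) (_ : ∀ θ, MeasurableSpace (Ω θ))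
    (P : ∀ θ, Measure (Ω θ)) (_ : ∀ θ, IsProbabilityMeasure (P θ))
    (N : ∀ θ, Ω θ → ℕ) (X : ∀ θ, ℕ → Ω θ → ℝ),
    (∀ θ, IsRandomSumModel (P θ) (N θ) (X θ)) ∧
    (∀ θ, HasPGF (P θ) (N θ) (fun s => φ ((1 - (s : ℂ)) / ((θ : ℝ) : ℂ)))) ∧
    (∃ (G : Measure ℝ) (_ : IsProbabilityMeasure G),
      HasLimitLaw P (fun θ ω => ∑ j ∈ Finset.range ⌊1 / (θ : ℝ)⌋₊, X θ j ω) G) ∧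
    HasLimitLaw P (fun θ ω => ∑ j ∈ Finset.range (N θ ω), X θ j ω) ν

/-! For `c ≥ 0` and a characteristic function `f`, `φ (c (1 - f))` is again a characteristic
function: that of a sum of a mixed Poisson number of i.i.d. terms. If the random sums converge,
taking `θ = 1/(n+1)` therefore exhibits their limit as `φ`-ID with `aₙ = n + 1`.

Conversely, the point is to write the characteristic function of `ν` as `φ ∘ ψ` with every `exp (-y
ψ)`, `y > 0`, a characteristic function (`IsPhiID.exists_exponent`). Put `gₙ = aₙ (1 - fₙ)`. The
laws with characteristic functions `φ ∘ gₙ` converge, hence are tight, so `φ ∘ gₙ` is uniformly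
close to `1` near `0`. If `φ` is not constant, it avoids `1` on small half circles around `0`, and
the continuous path `gₙ`, starting at `0`, cannot cross such a half circle; so `gₙ` is uniformly
small near `0` (`IsLaplaceTransform.exists_norm_le`). A doubling inequality makes `gₙ(t)` bounded in
`n` for every `t`, and `ψ` is a limit along an ultrafilter. The compound Poisson functions `exp (-y
gₙ)` form a tight family, so their limit `exp (-y ψ)` is a characteristic function.

Summands with characteristic function `exp (-θ ψ)` then give classical sums tending to `exp (-ψ)`
and random sums `φ ((1 - exp (-θ ψ)) / θ)` tending to `φ ∘ ψ`. -/

/-! ### Mixed Poisson laws and random sums -/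

lemma integral_pow_poissonMeasure (r : NNReal) (z : ℂ) :
    ∫ n, z ^ n ∂(poissonMeasure r) = Complex.exp (-((1 - z) * r)) := by
  rw [integral_poissonMeasure]
  have h : ∀ n : ℕ, (Real.exp (-r) * (r : ℝ) ^ n / (n.factorial : ℝ)) • z ^ n
      = Complex.exp (-r) * ((r * z) ^ n / (n.factorial : ℂ)) := by
    intro n
    rw [Complex.real_smul]
    push_cast
    rw [mul_pow]
    ring
  simp_rw [h]
  rw [tsum_mul_left, (NormedSpace.expSeries_div_hasSum_exp ((r : ℂ) * z)).tsum_eq,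
    ← Complex.exp_eq_exp_ℂ, ← Complex.exp_add]
  ring_nf

lemma measurable_poissonMeasure : Measurable poissonMeasure := by
  refine Measure.measurable_of_measurable_coe _ fun s _ => ?_
  have h : ∀ r, poissonMeasure r s
      = ∑' n : ℕ, ENNReal.ofReal (Real.exp (-r) * (r : ℝ) ^ n / (n.factorial : ℝ))
        * Measure.dirac n s := by
    intro r
    rw [poissonMeasure, Measure.sum_apply _ (by measurability)]
    simp
  simp_rw [h]
  fun_prop

/-- Mixed Poisson laws: every probability law `μ` on `[0, ∞)` is the mixing law of a law on `ℕ`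
whose generating function is `z ↦ ∫ exp (-(1 - z) x) dμ(x)`. -/
lemma exists_mixedPoisson (μ : Measure ℝ) [IsProbabilityMeasure μ] (hμ : ∀ᵐ x ∂μ, 0 ≤ x) :
    ∃ ρ : Measure ℕ, IsProbabilityMeasure ρ ∧
      ∀ z : ℂ, ‖z‖ ≤ 1 → ∫ n, z ^ n ∂ρ = ∫ x : ℝ, Complex.exp (-((1 - z) * x)) ∂μ := by
  let K : Kernel ℝ ℕ := ⟨fun x => poissonMeasure x.toNNReal,
    measurable_poissonMeasure.comp measurable_real_toNNReal⟩
  have hK : IsMarkovKernel K := ⟨fun x => by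
    change IsProbabilityMeasure (poissonMeasure x.toNNReal); infer_instance⟩
  refine ⟨K ∘ₘ μ, inferInstance, fun z hz => ?_⟩
  have hint : Integrable (fun n : ℕ => z ^ n) (K ∘ₘ μ) := by
    refine Integrable.of_bound (C := 1) (by fun_prop) (ae_of_all _ fun n => ?_)
    simpa using pow_le_one₀ (norm_nonneg z) hz
  rw [Measure.comp_eq_comp_const_apply] at hint ⊢
  rw [Kernel.integral_comp hint, Kernel.const_apply]
  refine integral_congr_ae ?_
  filter_upwards [hμ] with x hx
  change ∫ n, z ^ n ∂(poissonMeasure x.toNNReal) = _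
  rw [integral_pow_poissonMeasure]
  simp [Real.coe_toNNReal x hx]

lemma exists_isRandomSumModel (ρ : Measure ℕ) [IsProbabilityMeasure ρ]
    (κ : Measure ℝ) [IsProbabilityMeasure κ] :
    ∃ (Ω : Type u) (_ : MeasurableSpace Ω) (P : Measure Ω) (_ : IsProbabilityMeasure P)
      (N : Ω → ℕ) (X : ℕ → Ω → ℝ),
      IsRandomSumModel P N X ∧ P.map N = ρ ∧ P.map (X 0) = κ := by
  -- The product space lives in `Type`; `ULift` carries it to the universe `u`.
  let Q : Measure (ℕ × (ℕ → ℝ)) := ρ.prod (Measure.infinitePi fun _ => κ)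
  have hup : Measurable (ULift.up.{u} : ℕ × (ℕ → ℝ) → _) := measurable_up
  have hdown : Measurable (ULift.down.{u} : _ → ℕ × (ℕ → ℝ)) := measurable_down
  have hP : IsProbabilityMeasure (Q.map ULift.up.{u}) :=
    Measure.isProbabilityMeasure_map hup.aemeasurable
  have hX : ∀ j : ℕ, Measurable fun ω : ULift.{u} (ℕ × (ℕ → ℝ)) => ω.down.2 j :=
    fun j => (measurable_pi_apply j).comp (measurable_snd.comp hdown)
  have hN : Measurable fun ω : ULift.{u} (ℕ × (ℕ → ℝ)) => ω.down.1 := measurable_fst.comp hdown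
  have hXX : Measurable fun ω : ULift.{u} (ℕ × (ℕ → ℝ)) => fun j => ω.down.2 j :=
    measurable_snd.comp hdown
  have lawN : (Q.map ULift.up.{u}).map (fun ω => ω.down.1) = ρ := by
    rw [Measure.map_map hN hup]
    exact Measure.map_fst_prod.trans (by simp)
  have lawXX : (Q.map ULift.up.{u}).map (fun ω j => ω.down.2 j)
      = Measure.infinitePi fun _ => κ := by
    rw [Measure.map_map hXX hup]
    exact Measure.map_snd_prod.trans (by simp)
  have lawX : ∀ j, (Q.map ULift.up.{u}).map (fun ω => ω.down.2 j) = κ := by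
    intro j
    rw [← Measure.infinitePi_map_eval (fun _ : ℕ => κ) j, ← lawXX,
      Measure.map_map (measurable_pi_apply j) hXX]
    rfl
  refine ⟨ULift.{u} (ℕ × (ℕ → ℝ)), inferInstance, Q.map ULift.up, hP, fun ω => ω.down.1,
    fun j ω => ω.down.2 j, ⟨hN, hX, ?_, fun j => ?_, ?_⟩, lawN, lawX 0⟩
  · rw [iIndepFun_iff_map_fun_eq_infinitePi_map hX, lawXX]
    simp_rw [lawX]
  · exact ⟨(hX j).aemeasurable, (hX 0).aemeasurable, by rw [lawX, lawX]⟩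
  · rw [indepFun_iff_map_prod_eq_prod_map_map hN.aemeasurable hXX.aemeasurable, lawN, lawXX,
      Measure.map_map (hN.prodMk hXX) hup]
    exact Measure.map_id

lemma measurable_sum_range_prod :
    Measurable fun p : ℕ × (ℕ → ℝ) => ∑ j ∈ Finset.range p.1, p.2 j :=
  measurable_from_prod_countable_right fun n => by
    change Measurable fun x : ℕ → ℝ => ∑ j ∈ Finset.range n, x j
    fun_prop

namespace IsRandomSumModel

variable {Ω : Type u} [MeasurableSpace Ω] {P : Measure Ω} {N : Ω → ℕ} {X : ℕ → Ω → ℝ}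

lemma measurable_randomSum (h : IsRandomSumModel P N X) :
    Measurable fun ω => ∑ j ∈ Finset.range (N ω), X j ω :=
  measurable_sum_range_prod.comp (h.measurable_N.prodMk (measurable_pi_lambda _ h.measurable_X))

lemma charFun_sum_range (h : IsRandomSumModel P N X) (n : ℕ) (t : ℝ) :
    charFun (P.map fun ω => ∑ j ∈ Finset.range n, X j ω) t = charFun (P.map (X 0)) t ^ n := by
  rw [iIndepFun.charFun_map_fun_finsetSum_eq_prod (fun i _ => (h.measurable_X i).aemeasurable)
    (h.indep_X.restrict _)]
  simp [(h.identDistrib_X _).map_eq]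

lemma charFun_randomSum [IsProbabilityMeasure P] (h : IsRandomSumModel P N X) (t : ℝ) :
    charFun (P.map fun ω => ∑ j ∈ Finset.range (N ω), X j ω) t
      = ∫ n, charFun (P.map (X 0)) t ^ n ∂(P.map N) := by
  have hXX : Measurable fun ω j => X j ω := measurable_pi_lambda _ h.measurable_X
  have hNm := h.measurable_N
  have hmap : P.map (fun ω => ∑ j ∈ Finset.range (N ω), X j ω)
      = ((P.map N).prod (P.map fun ω j => X j ω)).map
        fun p => ∑ j ∈ Finset.range p.1, p.2 j := by
    rw [← (indepFun_iff_map_prod_eq_prod_map_map hNm.aemeasurable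
      hXX.aemeasurable).1 h.indep_N_X, Measure.map_map measurable_sum_range_prod (hNm.prodMk hXX)]
    rfl
  have : IsProbabilityMeasure (P.map N) := Measure.isProbabilityMeasure_map hNm.aemeasurable
  have : IsProbabilityMeasure (P.map fun ω j => X j ω) :=
    Measure.isProbabilityMeasure_map hXX.aemeasurable
  have hmeas := measurable_sum_range_prod
  rw [hmap, charFun_apply_real, integral_map hmeas.aemeasurable (by fun_prop), integral_prod]
  · refine integral_congr_ae (ae_of_all _ fun n => ?_)
    simp only
    rw [← h.charFun_sum_range n t, charFun_apply_real, integral_map hXX.aemeasurable (by fun_prop),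
      integral_map]
    · exact (Finset.measurable_sum _ fun j _ => h.measurable_X j).aemeasurable
    · fun_prop
  · refine Integrable.of_bound (C := 1) (Measurable.aestronglyMeasurable (by fun_prop))
      (ae_of_all _ fun p => ?_)
    rw [← Complex.ofReal_mul, Complex.norm_exp_ofReal_mul_I]

end IsRandomSumModel

/-! ### Generating functions and the characteristic functions `φ (c (1 - f))` -/

lemma hasSum_integral_pow (ρ : Measure ℕ) [IsProbabilityMeasure ρ] {s : ℝ} (h : |s| ≤ 1) :
    HasSum (fun n => s ^ n • ρ.real {n}) (∫ n, s ^ n ∂ρ) := by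
  have hint : Integrable (fun n : ℕ => s ^ n) ρ := by
    refine Integrable.of_bound (C := 1) (by fun_prop) (ae_of_all _ fun n => ?_)
    simpa using pow_le_one₀ (abs_nonneg s) h
  have := hasSum_integral_iUnion (μ := ρ) (f := fun n : ℕ => s ^ n) (s := fun n : ℕ => {n})
    (fun n => MeasurableSet.singleton n) (fun i j hij => by simpa using hij)
    hint.integrableOn
  simpa [mul_comm, Set.iUnion_of_singleton, measureReal_def] using this

lemma hasFPowerSeriesAt_integral_pow (ρ : Measure ℕ) [IsProbabilityMeasure ρ] :
    HasFPowerSeriesAt (fun s : ℝ => ∫ n, s ^ n ∂ρ)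
      (FormalMultilinearSeries.ofScalars ℝ fun n => ρ.real {n}) 0 := by
  rw [hasFPowerSeriesAt_iff]
  filter_upwards [Metric.ball_mem_nhds (0 : ℝ) one_pos] with s hs
  have hs' : |s| ≤ 1 := by simpa using (mem_ball_zero_iff.1 hs).le
  simpa [FormalMultilinearSeries.coeff_ofScalars] using hasSum_integral_pow ρ hs'

/-- A law on `ℕ` is determined by its generating function on `(0, 1)`. -/
lemma ext_of_integral_pow_eq (ρ ρ' : Measure ℕ) [IsProbabilityMeasure ρ] [IsProbabilityMeasure ρ']
    (h : ∀ s : ℝ, 0 < s → s < 1 → ∫ n, s ^ n ∂ρ = ∫ n, s ^ n ∂ρ') : ρ = ρ' := by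
  have hρ := hasFPowerSeriesAt_integral_pow ρ
  have hρ' := hasFPowerSeriesAt_integral_pow ρ'
  have hfreq : ∃ᶠ s in 𝓝[≠] (0 : ℝ), ∫ n, s ^ n ∂ρ = ∫ n, s ^ n ∂ρ' := by
    have : ∀ᶠ s in 𝓝[>] (0 : ℝ), ∫ n, s ^ n ∂ρ = ∫ n, s ^ n ∂ρ' := by
      filter_upwards [Ioo_mem_nhdsGT (one_pos (α := ℝ))] with s hs using h s hs.1 hs.2
    -- Agreement on one side of `0` suffices for the identity theorem.
    exact this.frequently.filter_mono (nhdsGT_le_nhdsNE 0)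
  have heq := (hρ.analyticAt.frequently_eq_iff_eventually_eq hρ'.analyticAt).1 hfreq
  have hseries := hρ.eq_formalMultilinearSeries (hρ'.congr (heq.mono fun _ hx => hx.symm))
  refine Measure.ext_of_singleton fun n => ?_
  have hn := congrArg (fun p => FormalMultilinearSeries.coeff p n) hseries
  simp only [FormalMultilinearSeries.coeff_ofScalars] at hn
  exact (measureReal_eq_measureReal_iff).1 hn

lemma one_sub_re_nonneg_of_norm_le_one {z : ℂ} (hz : ‖z‖ ≤ 1) : 0 ≤ (1 - z).re := by
  have := (Complex.re_le_norm z).trans hz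
  simpa using this

namespace IsLaplaceTransform

variable {φ : ℂ → ℂ}

lemma exists_law_nat (hφ : IsLaplaceTransform φ) {c : ℝ} (hc : 0 ≤ c) :
    ∃ ρ : Measure ℕ, IsProbabilityMeasure ρ ∧
      ∀ z : ℂ, ‖z‖ ≤ 1 → ∫ n, z ^ n ∂ρ = φ (c * (1 - z)) := by
  obtain ⟨μ, hμ, hpos, hφμ⟩ := hφ
  have hm : Measurable fun x : ℝ => c * x := by fun_prop
  have : IsProbabilityMeasure (μ.map fun x => c * x) :=
    Measure.isProbabilityMeasure_map hm.aemeasurable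
  obtain ⟨ρ, hρ, h⟩ := exists_mixedPoisson (μ.map fun x => c * x) (by
    rw [ae_map_iff hm.aemeasurable measurableSet_Ici]
    filter_upwards [hpos] with x hx using mul_nonneg hc hx)
  refine ⟨ρ, hρ, fun z hz => ?_⟩
  rw [h z hz, integral_map hm.aemeasurable (by fun_prop), hφμ]
  · refine integral_congr_ae (ae_of_all _ fun x => ?_)
    simp only [Complex.ofReal_mul]
    ring_nf
  · rw [Complex.re_ofReal_mul]
    exact mul_nonneg hc (one_sub_re_nonneg_of_norm_le_one hz)

/-- If `f` is a characteristic function, so is `φ (c (1 - f))`. -/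
lemma exists_charFun_eq (hφ : IsLaplaceTransform φ) {c : ℝ} (hc : 0 ≤ c) (κ : Measure ℝ)
    [IsProbabilityMeasure κ] :
    ∃ Q : Measure ℝ, IsProbabilityMeasure Q ∧ ∀ t, charFun Q t = φ (c * (1 - charFun κ t)) := by
  obtain ⟨ρ, hρ, h⟩ := hφ.exists_law_nat hc
  obtain ⟨Ω, _, P, _, N, X, hNX, rfl, rfl⟩ := exists_isRandomSumModel.{0} ρ κ
  refine ⟨P.map fun ω => ∑ j ∈ Finset.range (N ω), X j ω,
    Measure.isProbabilityMeasure_map hNX.measurable_randomSum.aemeasurable, fun t => ?_⟩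
  rw [hNX.charFun_randomSum, h _ (norm_charFun_le_one t)]

end IsLaplaceTransform

lemma isLaplaceTransform_exp_neg : IsLaplaceTransform fun z => Complex.exp (-z) :=
  ⟨Measure.dirac 1, inferInstance, by simp [ae_dirac_eq], fun z _ => by simp⟩

/-- The generating function of `N`, given on `(0, 1)`, extends to the closed complex unit disc. -/
lemma HasPGF.integral_pow_eq {Ω : Type u} [MeasurableSpace Ω] {P : Measure Ω}
    [IsProbabilityMeasure P] {N : Ω → ℕ} (hN : Measurable N) {φ : ℂ → ℂ}
    (hφ : IsLaplaceTransform φ) {θ : ℝ} (hθ : 0 < θ)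
    (h : HasPGF P N fun s => φ ((1 - (s : ℂ)) / (θ : ℂ))) {z : ℂ} (hz : ‖z‖ ≤ 1) :
    ∫ n, z ^ n ∂(P.map N) = φ ((1 - z) / θ) := by
  have hdiv : ∀ z : ℂ, (1 - z) / (θ : ℂ) = (θ⁻¹ : ℝ) * (1 - z) := fun z => by
    push_cast; ring
  obtain ⟨ρ, hρ, hρφ⟩ := hφ.exists_law_nat (inv_nonneg.2 hθ.le)
  have : IsProbabilityMeasure (P.map N) := Measure.isProbabilityMeasure_map hN.aemeasurable
  rw [ext_of_integral_pow_eq (P.map N) ρ fun s h0 h1 => ?_, hρφ z hz, hdiv]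
  have h2 := h s h0 h1
  simp only [hdiv] at h2
  rw [← hρφ s (by simpa [abs_of_pos h0] using h1.le)] at h2
  rw [integral_map hN.aemeasurable (by fun_prop)]
  rw [← Complex.ofReal_inj, h2, ← integral_complex_ofReal]
  simp

/-! ### Tightness and characteristic functions near `0` -/

/-- `|1 - exp (itx)|` is at most `|tx| ≤ K |t|` when `|x| ≤ K`, and at most `2` otherwise. -/
lemma norm_one_sub_charFun_le (μ : Measure ℝ) [IsProbabilityMeasure μ] (t : ℝ) {K : ℝ}
    (hK : 0 ≤ K) : ‖1 - charFun μ t‖ ≤ K * |t| + 2 * μ.real {x | K < ‖x‖} := by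
  have hint : Integrable (fun x : ℝ => Complex.exp (t * x * Complex.I)) μ := by
    refine Integrable.of_bound (C := 1) (by fun_prop) (ae_of_all _ fun x => ?_)
    rw [← Complex.ofReal_mul, Complex.norm_exp_ofReal_mul_I]
  have hset : MeasurableSet {x : ℝ | K < ‖x‖} := measurableSet_lt (by fun_prop) (by fun_prop)
  have h1 : 1 - charFun μ t = ∫ x : ℝ, (1 - Complex.exp (t * x * Complex.I)) ∂μ := by
    rw [integral_sub (integrable_const _) hint, charFun_apply_real]
    simp
  have hind : Integrable ({x : ℝ | K < ‖x‖}.indicator fun _ => (2 : ℝ)) μ :=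
    (integrable_const _).indicator hset
  calc ‖1 - charFun μ t‖
      ≤ ∫ x : ℝ, (K * |t| + {x : ℝ | K < ‖x‖}.indicator (fun _ => (2 : ℝ)) x) ∂μ := by
        rw [h1]
        refine norm_integral_le_of_norm_le ((integrable_const _).add hind)
          (ae_of_all _ fun x => ?_)
        by_cases hx : K < ‖x‖
        · rw [Set.indicator_of_mem (by exact hx)]
          refine (norm_sub_le _ _).trans ?_
          rw [← Complex.ofReal_mul, Complex.norm_exp_ofReal_mul_I, norm_one]
          nlinarith [mul_nonneg hK (abs_nonneg t)]
        · rw [Set.indicator_of_notMem (by exact hx), add_zero, norm_sub_rev, mul_comm _ Complex.I,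
            ← Complex.ofReal_mul]
          refine (Real.norm_exp_I_mul_ofReal_sub_one_le).trans ?_
          rw [norm_mul, mul_comm]
          exact mul_le_mul_of_nonneg_right (not_lt.1 hx) (norm_nonneg _)
    _ = K * |t| + 2 * μ.real {x | K < ‖x‖} := by
        rw [integral_add (integrable_const _) hind, integral_indicator hset]
        simp [mul_comm]

/-- The characteristic functions of a tight family are equicontinuous at `0`. -/
lemma MeasureTheory.IsTightMeasureSet.exists_norm_one_sub_charFun_le {ι : Type*} {μ : ι → Measure ℝ}
    [∀ i, IsProbabilityMeasure (μ i)] (h : IsTightMeasureSet (Set.range μ)) {ε : ℝ} (hε : 0 < ε) :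
    ∃ T > 0, ∀ i, ∀ t : ℝ, |t| ≤ T → ‖1 - charFun (μ i) t‖ ≤ ε := by
  have h1 := tendsto_measure_norm_gt_of_isTightMeasureSet h
  rw [ENNReal.tendsto_atTop_zero] at h1
  obtain ⟨K, hK⟩ := h1 (ENNReal.ofReal (ε / 4)) (by simpa using hε)
  set R := max K 1
  have hR : 0 < R := lt_of_lt_of_le one_pos (le_max_right _ _)
  refine ⟨ε / (2 * R), by positivity, fun i t ht => ?_⟩
  have h2 : (μ i).real {x | R < ‖x‖} ≤ ε / 4 := by
    refine ENNReal.toReal_le_of_le_ofReal (by positivity) (le_trans ?_ (hK R (le_max_left _ _)))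
    exact le_iSup₂_of_le (μ i) ⟨i, rfl⟩ le_rfl
  have h3 := norm_one_sub_charFun_le (μ i) t hR.le
  have h4 : R * |t| ≤ ε / 2 := by
    rw [le_div_iff₀ (by positivity)] at ht
    linarith
  linarith

/-- The mass outside `[-r, r]` is at most `r / 2` times the norm of the integral of `1 - charFun`
over `[-2/r, 2/r]`. That interval has length `4 / r`, so a bound `δ / 2` on the integrand gives mass
at most `δ`. -/
lemma isTightMeasureSet_of_norm_one_sub_charFun_le {ι : Type*} {μ : ι → Measure ℝ}
    [∀ i, IsProbabilityMeasure (μ i)]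
    (h : ∀ ε > 0, ∃ T > 0, ∀ i, ∀ t : ℝ, |t| ≤ T → ‖1 - charFun (μ i) t‖ ≤ ε) :
    IsTightMeasureSet (Set.range μ) := by
  refine isTightMeasureSet_of_tendsto_measure_norm_gt ?_
  rw [ENNReal.tendsto_atTop_zero]
  intro ε hε
  obtain ⟨δ, hδ, hδε⟩ : ∃ δ : ℝ, 0 < δ ∧ ENNReal.ofReal δ ≤ ε := by
    obtain ⟨q, hq, hqε⟩ := ENNReal.lt_iff_exists_nnreal_btwn.1 hε
    exact ⟨q, by simpa using hq, by simpa using hqε.le⟩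
  obtain ⟨T, hT, hle⟩ := h (δ / 2) (by positivity)
  refine ⟨2 / T, fun r hr => ?_⟩
  have hr0 : 0 < r := lt_of_lt_of_le (by positivity) hr
  refine iSup₂_le ?_
  rintro _ ⟨i, rfl⟩
  refine le_trans ?_ hδε
  rw [← ENNReal.ofReal_toReal (measure_ne_top (μ i) _)]
  refine ENNReal.ofReal_le_ofReal ((measureReal_abs_gt_le_integral_charFun hr0).trans ?_)
  have hb : ‖∫ t in (-2 * r⁻¹)..(2 * r⁻¹), 1 - charFun (μ i) t‖
      ≤ δ / 2 * |2 * r⁻¹ - -2 * r⁻¹| := by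
    refine intervalIntegral.norm_integral_le_of_norm_le_const fun t ht => hle i t ?_
    have h2r : 2 * r⁻¹ ≤ T := by
      rw [← div_eq_mul_inv]
      rw [ge_iff_le, div_le_iff₀ hT] at hr
      rw [div_le_iff₀ hr0]; linarith
    have hri : 0 < r⁻¹ := inv_pos.2 hr0
    rw [Set.uIoc_of_le (by linarith)] at ht
    rw [abs_le]
    constructor <;> linarith [ht.1, ht.2]
  have hri : 0 < r⁻¹ := inv_pos.2 hr0
  have habs : |2 * r⁻¹ - -2 * r⁻¹| = 4 * r⁻¹ := by rw [abs_of_nonneg] <;> linarith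
  rw [habs] at hb
  calc 2⁻¹ * r * ‖∫ t in (-2 * r⁻¹)..(2 * r⁻¹), 1 - charFun (μ i) t‖
      ≤ 2⁻¹ * r * (δ / 2 * (4 * r⁻¹)) := by gcongr
    _ = δ := by field_simp; norm_num

/-- Along an ultrafilter, the characteristic functions of a tight family converge to a
characteristic function. -/
lemma exists_charFun_eq_of_tendsto_ultrafilter {ι : Type*} (U : Ultrafilter ι)
    {μ : ι → Measure ℝ} [hμ : ∀ i, IsProbabilityMeasure (μ i)]
    (ht : IsTightMeasureSet (Set.range μ)) {f : ℝ → ℂ}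
    (h : ∀ t, Tendsto (fun i => charFun (μ i) t) U (𝓝 (f t))) :
    ∃ Q : Measure ℝ, IsProbabilityMeasure Q ∧ ∀ t, charFun Q t = f t := by
  let m : ι → ProbabilityMeasure ℝ := fun i => ⟨μ i, hμ i⟩
  have hc : IsCompact (closure (Set.range m)) := by
    refine isCompact_closure_of_isTightMeasureSet ?_
    convert! ht using 1
    ext κ
    constructor
    · rintro ⟨_, ⟨i, rfl⟩, rfl⟩
      exact ⟨i, rfl⟩
    · rintro ⟨i, rfl⟩
      exact ⟨m i, ⟨i, rfl⟩, rfl⟩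
  obtain ⟨Q, -, hQ : Tendsto _ _ _⟩ := hc.ultrafilter_le_nhds (U.map m)
    (.trans (by simp) (monotone_principal subset_closure))
  refine ⟨Q, Q.2, fun t => tendsto_nhds_unique ?_ (h t)⟩
  rw [ProbabilityMeasure.tendsto_iff_forall_integral_rclike_tendsto ℂ] at hQ
  simpa [charFun_eq_integral_innerProbChar, m] using hQ (BoundedContinuousFunction.innerProbChar t)

/-! ### The Laplace transform near `0` -/

lemma norm_exp_neg_mul_ofReal_le_one {z : ℂ} (hz : 0 ≤ z.re) {x : ℝ} (hx : 0 ≤ x) :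
    ‖Complex.exp (-(z * x))‖ ≤ 1 := by
  rw [Complex.norm_exp, Real.exp_le_one_iff, Complex.neg_re, Complex.re_mul_ofReal]
  exact neg_nonpos.2 (mul_nonneg hz hx)

namespace IsLaplaceTransform

variable {φ : ℂ → ℂ}

lemma continuousOn (hφ : IsLaplaceTransform φ) : ContinuousOn φ {z | 0 ≤ z.re} := by
  obtain ⟨μ, hμ, hpos, hφμ⟩ := hφ
  refine ContinuousOn.congr (f := fun z : ℂ => ∫ x : ℝ, Complex.exp (-(z * x)) ∂μ) ?_
    fun z hz => hφμ z hz
  refine continuousOn_of_dominated (bound := fun _ => 1) (fun z _ => by fun_prop) (fun z hz => ?_)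
    (integrable_const _) (ae_of_all _ fun x => by fun_prop)
  filter_upwards [hpos] with x hx using norm_exp_neg_mul_ofReal_le_one hz hx

/-- Unless `φ` is constant, `φ ≠ 1` on all small half circles around `0`. -/
lemma exists_forall_ne_one (hφ : IsLaplaceTransform φ) (hne : ¬ ∀ z : ℂ, 0 ≤ z.re → φ z = 1) :
    ∃ R > 0, ∀ z : ℂ, 0 ≤ z.re → z ≠ 0 → ‖z‖ < R → φ z ≠ 1 := by
  obtain ⟨μ, hμ, hpos, hφμ⟩ := hφ
  -- Otherwise `μ` is the point mass at `0` and `φ` is constantly `1`.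
  have hM : ∃ M : ℕ, μ (Set.Ioo (0 : ℝ) M) ≠ 0 := by
    by_contra! hM
    have hU : μ (⋃ M : ℕ, Set.Ioo (0 : ℝ) M) = 0 := measure_iUnion_null hM
    have hzero : ∀ᵐ x ∂μ, x = 0 := by
      have hU' := measure_eq_zero_iff_ae_notMem.1 hU
      filter_upwards [hpos, hU'] with x hx hxU
      by_contra h0
      obtain ⟨n, hn⟩ := exists_nat_gt x
      exact hxU (Set.mem_iUnion.2 ⟨n, lt_of_le_of_ne hx (Ne.symm h0), hn⟩)
    refine hne fun z hz => ?_
    rw [hφμ z hz, integral_congr_ae (g := fun _ => (1 : ℂ))]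
    · simp
    · filter_upwards [hzero] with x hx
      simp [hx]
  obtain ⟨M, hM⟩ := hM
  have hM0 : (0 : ℝ) < M := by
    rcases Nat.eq_zero_or_pos M with rfl | h
    · simp at hM
    · exact_mod_cast h
  -- As `|exp (-zx)| ≤ 1`, the equality `φ z = 1` forces `exp (-zx) = 1` for almost every `x`, so
  -- `zx` is a multiple of `2πi`. For `0 < x < M` and `0 < ‖z‖ < 2π / M` this is impossible.
  refine ⟨2 * Real.pi / M, by positivity, fun z hz hz0 hzR h1 => ?_⟩
  have hint : Integrable (fun x : ℝ => Complex.exp (-(z * x))) μ := by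
    refine Integrable.of_bound (C := 1) (by fun_prop) ?_
    filter_upwards [hpos] with x hx using norm_exp_neg_mul_ofReal_le_one hz hx
  have hintexp : Integrable (fun x : ℝ => (Complex.exp (-(z * x))).re) μ := hint.re
  have hintre : Integrable (fun x : ℝ => 1 - (Complex.exp (-(z * x))).re) μ :=
    (integrable_const _).sub hintexp
  have hre : ∫ x : ℝ, (1 - (Complex.exp (-(z * x))).re) ∂μ = 0 := by
    rw [integral_sub (integrable_const _) hintexp]
    have : ∫ x : ℝ, (Complex.exp (-(z * x))).re ∂μ = 1 := by
      have := integral_re hint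
      simp only [RCLike.re_eq_complex_re] at this
      rw [this, ← hφμ z hz, h1, Complex.one_re]
    simp [this]
  have hae := (integral_eq_zero_iff_of_nonneg_ae (by
    filter_upwards [hpos] with x hx
    have := (Complex.re_le_norm _).trans (norm_exp_neg_mul_ofReal_le_one hz hx)
    simpa using this) hintre).1 hre
  have hnull : μ (Set.Ioo (0 : ℝ) M) = 0 := by
    refine measure_eq_zero_iff_ae_notMem.2 ?_
    filter_upwards [hae] with x hx hxM
    have hx1 : (Complex.exp (-(z * x))).re = 1 := by
      simp only [Pi.zero_apply] at hx
      linarith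
    have hexp : Complex.exp (-(z * x)) = 1 := by
      have hn := norm_exp_neg_mul_ofReal_le_one hz hxM.1.le
      have hsq : ‖Complex.exp (-(z * x))‖ ^ 2 ≤ 1 := pow_le_one₀ (norm_nonneg _) hn
      rw [← Complex.normSq_eq_norm_sq, Complex.normSq_apply, hx1] at hsq
      exact Complex.ext hx1 (by simp; nlinarith)
    obtain ⟨n, hn⟩ := Complex.exp_eq_one_iff.1 hexp
    have hnorm : ‖z‖ * x < 2 * Real.pi := by
      rw [lt_div_iff₀ hM0] at hzR
      exact lt_of_le_of_lt (mul_le_mul_of_nonneg_left hxM.2.le (norm_nonneg z)) hzR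
    have hnn : ‖z‖ * x = |(n : ℝ)| * (2 * Real.pi) := by
      have := congrArg norm hn
      simpa [abs_of_pos hxM.1, abs_of_pos Real.pi_pos] using this
    have hn1 : |(n : ℝ)| < 1 := by
      rw [hnn] at hnorm
      by_contra! h
      nlinarith [Real.pi_pos]
    have hn0 : n = 0 := Int.abs_lt_one_iff.1 (by exact_mod_cast hn1)
    rw [hn0] at hn
    simp [hz0, hxM.1.ne'] at hn
  exact hM hnull

/-- If `φ (g i)` is uniformly close to `1` near `0`, then `g i` is uniformly small near `0`. -/
lemma exists_norm_le (hφ : IsLaplaceTransform φ) (hne : ¬ ∀ z : ℂ, 0 ≤ z.re → φ z = 1)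
    {ι : Type*} {g : ι → ℝ → ℂ} (hg : ∀ i, Continuous (g i)) (hg0 : ∀ i, g i 0 = 0)
    (hre : ∀ i t, 0 ≤ (g i t).re)
    (h : ∀ ε > 0, ∃ T > 0, ∀ i, ∀ t : ℝ, |t| ≤ T → ‖1 - φ (g i t)‖ ≤ ε) {ε : ℝ} (hε : 0 < ε) :
    ∃ T > 0, ∀ i, ∀ t : ℝ, |t| ≤ T → ‖g i t‖ ≤ ε := by
  obtain ⟨R, hR, hφR⟩ := hφ.exists_forall_ne_one hne
  set r := min ε (R / 2)
  have hr : 0 < r := lt_min hε (by positivity)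
  have hrR : r < R := (min_le_right _ _).trans_lt (by linarith)
  obtain ⟨c, hc, hcφ⟩ : ∃ c > 0, ∀ z : ℂ, 0 ≤ z.re → ‖z‖ = r → c ≤ ‖1 - φ z‖ := by
    have hK : IsCompact (Metric.sphere (0 : ℂ) r ∩ {z | 0 ≤ z.re}) :=
      (isCompact_sphere _ _).inter_right (isClosed_le continuous_const Complex.continuous_re)
    obtain ⟨w, hw, hmin⟩ := hK.exists_isMinOn
      ⟨(r : ℂ), by simp [abs_of_pos hr], by simpa using hr.le⟩
      ((continuousOn_const.sub (hφ.continuousOn.mono Set.inter_subset_right)).norm)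
    refine ⟨‖1 - φ w‖, norm_pos_iff.2 (sub_ne_zero.2 (Ne.symm ?_)), fun z hz hzr =>
      hmin ⟨by simpa using hzr, hz⟩⟩
    have hwr : ‖w‖ = r := by simpa using hw.1
    exact hφR w hw.2 (norm_pos_iff.1 (hwr ▸ hr)) (hwr ▸ hrR)
  obtain ⟨T, hT, hle⟩ := h (c / 2) (by positivity)
  refine ⟨T, hT, fun i t ht => le_trans ?_ (min_le_left ε (R / 2))⟩
  by_contra! hlt
  have hcont : ContinuousOn (fun s => ‖g i s‖) (Set.uIcc 0 t) := (hg i).norm.continuousOn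
  -- A path leaving the disc of radius `r` meets its boundary, where `‖1 - φ‖ ≥ c`, at some `s`
  -- between `0` and `t`.
  obtain ⟨s, hs, hsr⟩ := intermediate_value_uIcc hcont
    (show r ∈ Set.uIcc ‖g i 0‖ ‖g i t‖ by
      rw [hg0, norm_zero, Set.uIcc_of_le (norm_nonneg _)]
      exact ⟨hr.le, hlt.le⟩)
  have hst : |s| ≤ |t| := by simpa using Set.abs_sub_left_of_mem_uIcc hs
  have h1 := hcφ (g i s) (hre i s) hsr
  have h2 := hle i s (hst.trans ht)
  linarith

end IsLaplaceTransform

/-! ### The exponent of a `φ`-infinitely divisible law -/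

/-- With `e = exp (itx)`, integrate `1 - e² = 2 (1 - e) - (1 - e)²` and use `|1 - e|² = 2 Re (1 -
e)`, valid because `|e| = 1`. -/
lemma norm_one_sub_charFun_two_mul_le (κ : Measure ℝ) [IsProbabilityMeasure κ] (t : ℝ) :
    ‖1 - charFun κ (2 * t)‖ ≤ 4 * ‖1 - charFun κ t‖ := by
  set e : ℝ → ℂ := fun x => Complex.exp (t * x * Complex.I) with he
  have hnorm : ∀ x, ‖e x‖ = 1 := fun x => by
    rw [he]; simp only; rw [← Complex.ofReal_mul, Complex.norm_exp_ofReal_mul_I]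
  have hem : Measurable e := by fun_prop
  have hint : Integrable e κ :=
    Integrable.of_bound (C := 1) hem.aestronglyMeasurable (ae_of_all _ fun x => (hnorm x).le)
  have hint2 : Integrable (fun x => e x ^ 2) κ :=
    Integrable.of_bound (C := 1) (by fun_prop) (ae_of_all _ fun x => by simp [hnorm])
  have hsub : Integrable (fun x => 1 - e x) κ := (integrable_const _).sub hint
  have hsq : ∀ x, (1 - e x) ^ 2 = 2 * (1 - e x) - (1 - e x ^ 2) := fun x => by ring
  have hsub2 : Integrable (fun x => 1 - e x ^ 2) κ := (integrable_const _).sub hint2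
  have h1f : ∫ x, (1 - e x) ∂κ = 1 - charFun κ t := by
    rw [integral_sub (integrable_const _) hint, charFun_apply_real]
    simp [he]
  have h2f : ∫ x, (1 - e x ^ 2) ∂κ = 1 - charFun κ (2 * t) := by
    rw [integral_sub (integrable_const _) hint2, charFun_apply_real]
    simp only [integral_const, probReal_univ, one_smul, he, ← Complex.exp_nat_mul]
    congr 2
    ext x
    push_cast
    ring_nf
  have hkey : 1 - charFun κ (2 * t) = 2 * (1 - charFun κ t) - ∫ x, (1 - e x) ^ 2 ∂κ := by
    simp_rw [hsq]
    rw [integral_sub (hsub.const_mul 2) hsub2, integral_const_mul, h1f, h2f]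
    ring
  have hbound : ‖∫ x, (1 - e x) ^ 2 ∂κ‖ ≤ 2 * (1 - charFun κ t).re := by
    rw [← h1f]
    have hre := integral_re hsub
    simp only [RCLike.re_eq_complex_re] at hre
    rw [← hre, ← integral_const_mul]
    refine norm_integral_le_of_norm_le (hsub.re.const_mul 2) (ae_of_all _ fun x => le_of_eq ?_)
    have hx : (e x).re * (e x).re + (e x).im * (e x).im = 1 := by
      rw [← Complex.normSq_apply, Complex.normSq_eq_norm_sq, hnorm, one_pow]
    rw [norm_pow, ← Complex.normSq_eq_norm_sq, Complex.normSq_apply]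
    simp only [Complex.sub_re, Complex.sub_im, Complex.one_re, Complex.one_im]
    linarith
  calc ‖1 - charFun κ (2 * t)‖
      ≤ ‖2 * (1 - charFun κ t)‖ + ‖∫ x, (1 - e x) ^ 2 ∂κ‖ := by rw [hkey]; exact norm_sub_le _ _
    _ ≤ 2 * ‖1 - charFun κ t‖ + 2 * ‖1 - charFun κ t‖ := by
        refine add_le_add (by simp) (hbound.trans ?_)
        exact mul_le_mul_of_nonneg_left (Complex.re_le_norm _) zero_le_two
    _ = 4 * ‖1 - charFun κ t‖ := by ring

lemma norm_one_sub_charFun_two_pow_mul_le (κ : Measure ℝ) [IsProbabilityMeasure κ] (t : ℝ)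
    (k : ℕ) : ‖1 - charFun κ (2 ^ k * t)‖ ≤ 4 ^ k * ‖1 - charFun κ t‖ := by
  induction k with
  | zero => simp
  | succ k ih =>
    calc ‖1 - charFun κ (2 ^ (k + 1) * t)‖ = ‖1 - charFun κ (2 * (2 ^ k * t))‖ := by ring_nf
      _ ≤ 4 * (4 ^ k * ‖1 - charFun κ t‖) := by
        refine (norm_one_sub_charFun_two_mul_le κ _).trans ?_
        gcongr
      _ = 4 ^ (k + 1) * ‖1 - charFun κ t‖ := by ring

/-- A `φ`-infinitely divisible law has characteristic function `φ ∘ ψ`, where `exp (-ψ)` is an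
infinitely divisible characteristic function. -/
lemma IsPhiID.exists_exponent {φ : ℂ → ℂ} (hφ : IsLaplaceTransform φ) {ν : Measure ℝ}
    [IsProbabilityMeasure ν] (h : IsPhiID φ ν) :
    ∃ ψ : ℝ → ℂ, (∀ t, 0 ≤ (ψ t).re) ∧ (∀ t, charFun ν t = φ (ψ t)) ∧
      ∀ y : ℝ, 0 < y → ∃ Q : Measure ℝ, IsProbabilityMeasure Q ∧
        ∀ t, charFun Q t = Complex.exp (-(y * ψ t)) := by
  obtain ⟨a, κ, ha, hκ, hlim⟩ := h
  have hre : ∀ n t, 0 ≤ ((a n : ℂ) * (1 - charFun (κ n) t)).re := fun n t => by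
    rw [Complex.re_ofReal_mul]
    exact mul_nonneg (ha n).le (one_sub_re_nonneg_of_norm_le_one (norm_charFun_le_one t))
  -- For constant `φ` the convergence does not control `aₙ (1 - fₙ)`, but then `ν` has
  -- characteristic function `1` and `ψ = 0` serves.
  by_cases hne : ∀ z : ℂ, 0 ≤ z.re → φ z = 1
  · refine ⟨0, by simp, fun t => ?_, fun y _ => ⟨Measure.dirac 0, inferInstance, by
      simp [charFun_dirac]⟩⟩
    rw [Pi.zero_apply, hne 0 (by simp)]
    refine tendsto_nhds_unique (hlim t) ?_
    simp_rw [hne _ (hre _ t)]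
    exact tendsto_const_nhds
  choose Q hQ hQφ using fun n => hφ.exists_charFun_eq (ha n).le (κ n)
  have hsmallφ : ∀ ε > 0, ∃ T > 0, ∀ n, ∀ t : ℝ, |t| ≤ T →
      ‖1 - φ (a n * (1 - charFun (κ n) t))‖ ≤ ε := by
    intro ε hε
    have htight : IsTightMeasureSet (Set.range Q) :=
      isTightMeasureSet_of_tendsto_charFun (f := charFun ν) continuous_charFun.continuousAt
        fun t => by simpa only [hQφ] using hlim t
    simpa only [hQφ] using htight.exists_norm_one_sub_charFun_le hε
  have hsmall : ∀ ε > 0, ∃ T > 0, ∀ n, ∀ t : ℝ, |t| ≤ T →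
      ‖a n * (1 - charFun (κ n) t)‖ ≤ ε := fun ε hε =>
    hφ.exists_norm_le hne (g := fun n t => a n * (1 - charFun (κ n) t))
      (fun n => continuous_const.mul (continuous_const.sub continuous_charFun))
      (fun n => by simp) hre hsmallφ hε
  have hbdd : ∀ t, ∃ C, ∀ n, ‖a n * (1 - charFun (κ n) t)‖ ≤ C := by
    intro t
    obtain ⟨T, hT, hle⟩ := hsmall 1 one_pos
    -- Halve `t` until it lies in `[-T, T]`; each doubling back costs a factor `4`.
    obtain ⟨k, hk⟩ := pow_unbounded_of_one_lt (|t| / T) one_lt_two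
    refine ⟨4 ^ k, fun n => ?_⟩
    have hk2 : (0 : ℝ) < 2 ^ k := by positivity
    have h1 := norm_one_sub_charFun_two_pow_mul_le (κ n) (t / 2 ^ k) k
    rw [mul_div_cancel₀ _ hk2.ne'] at h1
    have h2 := hle n (t / 2 ^ k) (by
      rw [abs_div, abs_of_pos hk2, div_le_iff₀ hk2]
      rw [div_lt_iff₀ hT] at hk
      linarith)
    rw [norm_mul] at h2 ⊢
    calc ‖(a n : ℂ)‖ * ‖1 - charFun (κ n) t‖
        ≤ ‖(a n : ℂ)‖ * (4 ^ k * ‖1 - charFun (κ n) (t / 2 ^ k)‖) := by gcongr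
      _ = 4 ^ k * (‖(a n : ℂ)‖ * ‖1 - charFun (κ n) (t / 2 ^ k)‖) := by ring
      _ ≤ 4 ^ k * 1 := by gcongr
      _ = 4 ^ k := mul_one _
  -- One ultrafilter gives limits at all real `t` at once, with no subsequence to extract.
  let U : Ultrafilter ℕ := Ultrafilter.of atTop
  have hU : (U : Filter ℕ) ≤ atTop := Ultrafilter.of_le atTop
  have hψ : ∀ t, ∃ w, Tendsto (fun n => a n * (1 - charFun (κ n) t)) U (𝓝 w) := by
    intro t
    obtain ⟨C, hC⟩ := hbdd t
    obtain ⟨w, -, hw⟩ := (isCompact_closedBall (0 : ℂ) C).ultrafilter_le_nhds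
      (U.map fun n => a n * (1 - charFun (κ n) t)) (by
        rw [Ultrafilter.coe_map, le_principal_iff, mem_map]
        exact univ_mem' fun n => by simpa using hC n)
    exact ⟨w, hw⟩
  choose ψ hψ using hψ
  have hψre : ∀ t, 0 ≤ (ψ t).re := fun t =>
    ge_of_tendsto' ((Complex.continuous_re.tendsto _).comp (hψ t)) fun n => hre n t
  refine ⟨ψ, hψre, fun t => ?_, fun y hy => ?_⟩
  · refine tendsto_nhds_unique ((hlim t).mono_left hU) ?_
    exact (hφ.continuousOn (ψ t) (hψre t)).tendsto.comp
      (tendsto_nhdsWithin_iff.2 ⟨hψ t, Eventually.of_forall fun n => hre n t⟩)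
  -- Compound Poisson laws: `exp (-z)` is the Laplace transform of the point mass at `1`.
  · choose S hS hSexp using fun n => isLaplaceTransform_exp_neg.exists_charFun_eq
      (mul_nonneg hy.le (ha n).le) (κ n)
    have hSeq : ∀ n t, charFun (S n) t = Complex.exp (-(y * (a n * (1 - charFun (κ n) t)))) :=
      fun n t => by rw [hSexp]; push_cast; ring_nf
    refine exists_charFun_eq_of_tendsto_ultrafilter U (μ := S)
      (isTightMeasureSet_of_norm_one_sub_charFun_le fun ε hε => ?_) fun t => ?_
    · have hcont : ContinuousAt (fun w : ℂ => 1 - Complex.exp (-(y * w))) 0 := by fun_prop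
      obtain ⟨δ, hδ, hδε⟩ := Metric.continuousAt_iff.1 hcont ε hε
      obtain ⟨T, hT, hle⟩ := hsmall (δ / 2) (by positivity)
      refine ⟨T, hT, fun n t ht => ?_⟩
      have := hδε (x := a n * (1 - charFun (κ n) t)) (by
        rw [dist_zero_right]; exact (hle n t ht).trans_lt (by linarith))
      rw [hSeq]
      simpa using this.le
    · simp_rw [hSeq]
      exact (Complex.continuous_exp.tendsto _).comp ((hψ t).const_mul _).neg

/-! ### Limits as `θ → 0` and the two implications -/

instance : thetaToZero.IsCountablyGenerated := by
  unfold thetaToZero; infer_instance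

lemma tendsto_coe_thetaToZero :
    Tendsto (fun θ : Set.Ioi (0 : ℝ) => (θ : ℝ)) thetaToZero (𝓝[>] 0) :=
  tendsto_nhdsWithin_iff.2 ⟨tendsto_comap, Eventually.of_forall fun θ => θ.2⟩

/-- **Lévy's continuity theorem** along a countably generated filter. -/
lemma MeasureTheory.ProbabilityMeasure.tendsto_iff_tendsto_charFun_of_isCountablyGenerated
    {ι : Type*} {l : Filter ι} [l.IsCountablyGenerated] {μ : ι → ProbabilityMeasure ℝ}
    {μ₀ : ProbabilityMeasure ℝ} :
    Tendsto μ l (𝓝 μ₀) ↔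
      ∀ t : ℝ, Tendsto (fun i => charFun (μ i : Measure ℝ) t) l
        (𝓝 (charFun (μ₀ : Measure ℝ) t)) := by
  constructor
  · intro h t
    refine tendsto_of_seq_tendsto fun x hx => ?_
    exact ProbabilityMeasure.tendsto_iff_tendsto_charFun.1 (h.comp hx) t
  · intro h
    refine tendsto_of_seq_tendsto fun x hx => ?_
    exact ProbabilityMeasure.tendsto_iff_tendsto_charFun.2 fun t => (h t).comp hx

lemma hasLimitLaw_iff {Ω : Set.Ioi (0 : ℝ) → Type u} [∀ θ, MeasurableSpace (Ω θ)]
    {P : ∀ θ, Measure (Ω θ)} [∀ θ, IsProbabilityMeasure (P θ)] {S : ∀ θ, Ω θ → ℝ}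
    (hS : ∀ θ, AEMeasurable (S θ) (P θ)) {ν : Measure ℝ} [IsProbabilityMeasure ν] :
    HasLimitLaw P S ν ↔
      ∀ t : ℝ, Tendsto (fun θ => charFun ((P θ).map (S θ)) t) thetaToZero (𝓝 (charFun ν t)) := by
  constructor
  · intro h t
    have := ProbabilityMeasure.tendsto_iff_tendsto_charFun_of_isCountablyGenerated.1 h.tendsto t
    simpa using this
  · intro h
    refine ⟨hS, aemeasurable_id, ?_⟩
    refine ProbabilityMeasure.tendsto_iff_tendsto_charFun_of_isCountablyGenerated.2 fun t => ?_
    simpa using h t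

lemma IsLimitOfRandomSums.isPhiID {φ : ℂ → ℂ} (hφ : IsLaplaceTransform φ) {ν : Measure ℝ}
    [IsProbabilityMeasure ν] (h : IsLimitOfRandomSums.{u} φ ν) : IsPhiID φ ν := by
  obtain ⟨Ω, _, P, _, N, X, hmodel, hpgf, -, hlim⟩ := h
  rw [hasLimitLaw_iff fun θ => (hmodel θ).measurable_randomSum.aemeasurable] at hlim
  let θ : ℕ → Set.Ioi (0 : ℝ) := fun n => ⟨1 / ((n : ℝ) + 1), by
    change (0 : ℝ) < _; positivity⟩
  have hθ : Tendsto θ atTop thetaToZero :=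
    tendsto_comap_iff.2 tendsto_one_div_add_atTop_nhds_zero_nat
  refine ⟨fun n => n + 1, fun n => (P (θ n)).map (X (θ n) 0), fun n => by positivity,
    fun n => Measure.isProbabilityMeasure_map ((hmodel _).measurable_X 0).aemeasurable,
    fun t => ((hlim t).comp hθ).congr fun n => ?_⟩
  have : IsProbabilityMeasure ((P (θ n)).map (X (θ n) 0)) :=
    Measure.isProbabilityMeasure_map ((hmodel _).measurable_X 0).aemeasurable
  simp only [Function.comp_apply]
  rw [(hmodel (θ n)).charFun_randomSum, (hpgf (θ n)).integral_pow_eq (hmodel (θ n)).measurable_N hφ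
    (θ n).2 (norm_charFun_le_one t)]
  congr 1
  simp only [θ]
  push_cast
  rw [div_div_eq_mul_div, div_one, mul_comm]

lemma tendsto_one_sub_exp_neg_mul_div (w : ℂ) :
    Tendsto (fun θ : ℝ => (1 - Complex.exp (-(θ * w))) / θ) (𝓝[>] 0) (𝓝 w) := by
  have hd : HasDerivAt (fun θ : ℝ => 1 - Complex.exp (-(θ * w))) w 0 := by
    have h1 : HasDerivAt (fun θ : ℝ => -((θ : ℂ) * w)) (-(1 * w)) 0 :=
      ((Complex.ofRealCLM.hasDerivAt (x := 0)).mul_const w).neg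
    simpa using h1.cexp.const_sub 1
  have h2 := hd.tendsto_slope.mono_left (nhdsGT_le_nhdsNE 0)
  refine h2.congr fun θ => ?_
  simp [slope_def_module, div_eq_inv_mul]

lemma tendsto_mul_floor_inv : Tendsto (fun θ : ℝ => θ * ⌊1 / θ⌋₊) (𝓝[>] 0) (𝓝 1) := by
  refine ((tendsto_nat_floor_div_atTop (R := ℝ)).comp tendsto_inv_nhdsGT_zero).congr fun θ => ?_
  simp [mul_comm]

lemma IsPhiID.isLimitOfRandomSums {φ : ℂ → ℂ} (hφ : IsLaplaceTransform φ) {ν : Measure ℝ}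
    [IsProbabilityMeasure ν] (h : IsPhiID φ ν) : IsLimitOfRandomSums.{u} φ ν := by
  obtain ⟨ψ, hψre, hψν, hψ⟩ := h.exists_exponent hφ
  -- The summands have characteristic function `exp (-θ ψ)`: the exponent lemma with `y = θ`. Below,
  -- `y = 1` gives the limit `G` of the classical sums.
  choose κ hκ hκψ using fun θ : Set.Ioi (0 : ℝ) => hψ θ θ.2
  choose ρ hρ hρφ using fun θ : Set.Ioi (0 : ℝ) => hφ.exists_law_nat (inv_nonneg.2 (le_of_lt θ.2))
  choose Ω mΩ P hP N X hmodel hN hX using fun θ => exists_isRandomSumModel.{u} (ρ θ) (κ θ)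
  obtain ⟨G, hG, hGψ⟩ := hψ 1 one_pos
  refine ⟨Ω, mΩ, P, hP, N, X, hmodel, fun θ s h0 h1 => ?_, ⟨G, hG, ?_⟩, ?_⟩
  · have hs := hρφ θ s (by simpa [abs_of_pos h0] using h1.le)
    rw [← hN, integral_map (hmodel θ).measurable_N.aemeasurable (by fun_prop)] at hs
    rw [← integral_complex_ofReal]
    push_cast at hs ⊢
    rw [hs, div_eq_inv_mul]
  · refine (hasLimitLaw_iff fun θ => (Finset.measurable_sum _ fun j _ =>
      (hmodel θ).measurable_X j).aemeasurable).2 fun t => ?_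
    simp_rw [(hmodel _).charFun_sum_range, hX, hκψ, hGψ, ← Complex.exp_nat_mul]
    refine (Complex.continuous_exp.tendsto _).comp ?_
    -- The exponent of the classical sum is `-θ ⌊1/θ⌋ ψ(t)`, and `θ ⌊1/θ⌋ → 1`.
    have h1 := (Complex.continuous_ofReal.tendsto _).comp
      (tendsto_mul_floor_inv.comp tendsto_coe_thetaToZero)
    refine (h1.mul_const (-ψ t)).congr' (Eventually.of_forall fun θ => ?_) |>.trans ?_
    · simp only [Function.comp_apply]
      push_cast
      ring
    · simp
  · refine (hasLimitLaw_iff fun θ => (hmodel θ).measurable_randomSum.aemeasurable).2 fun t => ?_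
    have hle : ∀ θ, ‖Complex.exp (-((θ : Set.Ioi (0 : ℝ)) * ψ t))‖ ≤ 1 := fun θ =>
      hκψ θ t ▸ norm_charFun_le_one t
    have heq : ∀ θ : Set.Ioi (0 : ℝ),
        charFun ((P θ).map fun ω => ∑ j ∈ Finset.range (N θ ω), X θ j ω) t
          = φ ((1 - Complex.exp (-((θ : ℝ) * ψ t))) / (θ : ℝ)) := fun θ => by
      rw [(hmodel θ).charFun_randomSum, hX, hN, hκψ, hρφ θ _ (hle θ)]
      push_cast
      rw [div_eq_inv_mul]
    simp_rw [heq, hψν t]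
    refine (hφ.continuousOn (ψ t) (hψre t)).tendsto.comp (tendsto_nhdsWithin_iff.2
      ⟨(tendsto_one_sub_exp_neg_mul_div (ψ t)).comp tendsto_coe_thetaToZero,
        Eventually.of_forall fun θ => ?_⟩)
    rw [Set.mem_ofPred_eq, Complex.div_ofReal_re]
    exact div_nonneg (one_sub_re_nonneg_of_norm_le_one (hle θ)) (le_of_lt θ.2)

theorem theorem2p5 (φ : ℂ → ℂ) (hφ : IsLaplaceTransform φ)
    (ν : Measure ℝ) [IsProbabilityMeasure ν] :
    IsLimitOfRandomSums.{u} φ ν ↔ IsPhiID φ ν :=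
  ⟨fun h => h.isPhiID hφ, fun h => h.isLimitOfRandomSums hφ⟩
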